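/- Fix $\kappa>0$ and put $\overline{\omega}(k)=\sqrt{\kappa^2+k^2}$, $\Omega(k)=\sqrt{\overline{\omega}(k)+k}$ and $v_g(k)=\overline{\omega}'(k)=k/\overline{\omega}(k)$ for $k\in\mathbb{R}$. For $k,x^0,x^1\in\mathbb{R}$ let $$U_k(x^0,x^1)=\frac{e^{-i(\overline{\omega}(k)x^0-kx^1)}}{\sqrt{2\pi}}\begin{pmatrix}\Omega(k)\\ \Omega(-k)\end{pmatrix},\qquad V_k(x^0,x^1)=\frac{e^{i(\overline{\omega}(k)x^0-kx^1)}}{\sqrt{2\pi}}\begin{pmatrix}-\Omega(k)\\ \Omega(-k)\end{pmatrix}.$$ Let $k_1<k_2$ be real numbers, let $a:[k_1,k_2]\to\mathbb{C}$ be continuous and not identically zero, and define the wave packets (free solutions of the Dirac equation in $1+1$ dimensions) $$U[a]=\int_{k_1}^{k_2}a(k)\,U_k\,\frac{dk}{2\overline{\omega}(k)},\qquad V[a]=\int_{k_1}^{k_2}a(k)\,V_k\,\frac{dk}{2\overline{\omega}(k)}.$$ For $\psi=(\psi^1,\psi^2):\mathbb{R}^2\to\mathbb{C}^2$ let $j^0_\psi=|\psi^1|^2+|\psi^2|^2$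 be the time component of its current and, for $\tau,\xi\in\mathbb{R}$, let $$\rho_{\psi,\tau}(\xi)=\frac{j^0_\psi(\tau,\xi)}{\|\psi_0\|^2},\qquad \|\psi_0\|^2=\int_{-\infty}^{\infty}j^0_\psi(0,\xi)\,d\xi .$$ Let $v_1,v_2\in\mathbb{R}$ satisfy $v_1<v_g(k_1)$ and $v_g(k_2)<v_2$. Then for $\psi=U[a]$ and for $\psi=V[a]$, $\rho_{\psi,\tau}$ is a probability density on $\mathbb{R}$ for every $\tau\in\mathbb{R}$ (it is integrable with integral $1$), and $$\lim_{\tau\to+\infty}\int_{\tau[v_1,v_2]}\rho_{\psi,\tau}(\xi)\,d\xi=\lim_{\tau\to-\infty}\int_{\tau[v_1,v_2]}\rho_{\psi,\tau}(\xi)\,d\xi=1,$$ where $\tau[v_1,v_2]=\{\tau v: v_1\le v\le v_2\}$. -/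

import Mathlib

open Filter Topology MeasureTheory
open scoped Pointwise

noncomputable section

namespace DiracPacket

/-- Space-time with its standard chart `p = (x⁰(p), x¹(p))`. -/
abbrev SpaceTime : Type := ℝ × ℝ

/-- The spinor space: a two-dimensional complex inner product space. The scalar product
`S(v, w)` is `inner ℂ v w`, conjugate-linear in `v`. The components `ψ¹, ψ²` with respect to
the orthonormal basis have the indices `0, 1` here. -/
abbrev Spinor : Type := EuclideanSpace ℂ (Fin 2)

/-- The gamma matrices: `γ⁰` exchanges the two basis vectors; `γ¹` maps the first one to the
second one and the second one to minus the first one. -/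
def gamma : Fin 2 → Matrix (Fin 2) (Fin 2) ℂ :=
  ![!![0, 1; 1, 0], !![0, -1; 1, 0]]

/-- The action of `γ^μ` on spinors. -/
def gammaAct (μ : Fin 2) (w : Spinor) : Spinor :=
  WithLp.toLp 2 ((gamma μ).mulVec w.ofLp)

/-- The Lorentz invariant indefinite inner product `L(v, w) = S(v, γ⁰ w)`. -/
def lorentzForm (v w : Spinor) : ℂ := inner ℂ v (gammaAct 0 w)

/-- The component `j^μ = L(ψ, γ^μ ψ)` (a real number) of the current of `ψ`. -/
def current (ψ : SpaceTime → Spinor) (μ : Fin 2) (p : SpaceTime) : ℝ :=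
  (lorentzForm (ψ p) (gammaAct μ (ψ p))).re

theorem current_zero (ψ : SpaceTime → Spinor) (p : SpaceTime) :
    current ψ 0 p = ‖ψ p 0‖ ^ 2 + ‖ψ p 1‖ ^ 2 := by
  simp [current, lorentzForm, gammaAct, gamma, Matrix.mulVec, dotProduct, PiLp.inner_apply,
    Fin.sum_univ_two, Complex.sq_norm, Complex.normSq_apply]
  try ring

theorem current_one (ψ : SpaceTime → Spinor) (p : SpaceTime) :
    current ψ 1 p = ‖ψ p 0‖ ^ 2 - ‖ψ p 1‖ ^ 2 := by
  simp [current, lorentzForm, gammaAct, gamma, Matrix.mulVec, dotProduct, PiLp.inner_apply,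
    Fin.sum_univ_two, Complex.sq_norm, Complex.normSq_apply]
  try ring

/-- The norm of the restriction of `ψ` to the time slice `x⁰ = τ`. -/
def sliceNorm (ψ : SpaceTime → Spinor) (τ : ℝ) : ℝ :=
  Real.sqrt (∫ ξ : ℝ, current ψ 0 (τ, ξ))

/-- The position density `ρ_{ψ,τ}` with respect to `dξ` on the time slice `x⁰ = τ`. -/
def density (ψ : SpaceTime → Spinor) (τ ξ : ℝ) : ℝ :=
  current ψ 0 (τ, ξ) / sliceNorm ψ 0 ^ 2

/-- The frequency function `ω̄(k) = √(κ² + k²)`. -/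
def freq (κ k : ℝ) : ℝ := Real.sqrt (κ ^ 2 + k ^ 2)

/-- `Ω(k) = √(ω̄(k) + k)`. -/
def bigOmega (κ k : ℝ) : ℝ := Real.sqrt (freq κ k + k)

/-- The group velocity `v_g(k) = k / ω̄(k)`. -/
def groupVelocity (κ k : ℝ) : ℝ := k / freq κ k

theorem hasDerivAt_freq {κ : ℝ} (hκ : 0 < κ) (k : ℝ) :
    HasDerivAt (freq κ) (groupVelocity κ k) k := by
  have h : HasDerivAt (fun x : ℝ => κ ^ 2 + x ^ 2) (2 * k) k := by
    simpa using (hasDerivAt_pow 2 k).const_add (κ ^ 2)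
  have h0 : κ ^ 2 + k ^ 2 ≠ 0 := by positivity
  have h1 := h.sqrt h0
  rw [mul_div_mul_left _ _ two_ne_zero] at h1
  exact h1

/-- The positive frequency spinor `u(k)`. -/
def spinorU (κ k : ℝ) : Spinor := !₂[(bigOmega κ k : ℂ), (bigOmega κ (-k) : ℂ)]

/-- The negative frequency spinor `v(k)`. -/
def spinorV (κ k : ℝ) : Spinor := !₂[-(bigOmega κ k : ℂ), (bigOmega κ (-k) : ℂ)]

/-- The plane wave `U_k = (2π)^{-1/2} exp(-i (ω̄(k) x⁰ - k x¹)) u(k)`. -/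
def planeU (κ k : ℝ) (p : SpaceTime) : Spinor :=
  (((Real.sqrt (2 * Real.pi) : ℝ) : ℂ)⁻¹ *
    Complex.exp (-Complex.I * ((freq κ k * p.1 - k * p.2 : ℝ) : ℂ))) • spinorU κ k

/-- The plane wave `V_k = (2π)^{-1/2} exp(i (ω̄(k) x⁰ - k x¹)) v(k)`. -/
def planeV (κ k : ℝ) (p : SpaceTime) : Spinor :=
  (((Real.sqrt (2 * Real.pi) : ℝ) : ℂ)⁻¹ *
    Complex.exp (Complex.I * ((freq κ k * p.1 - k * p.2 : ℝ) : ℂ))) • spinorV κ k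

/-- The positive frequency packet `U[a] = ∫ a(k) U_k dk / (2 ω̄(k))` over `[k₁, k₂]`. -/
def packetU (κ k₁ k₂ : ℝ) (a : ℝ → ℂ) (p : SpaceTime) : Spinor :=
  ∫ k in Set.Icc k₁ k₂, (a k / ((2 * freq κ k : ℝ) : ℂ)) • planeU κ k p

/-- The negative frequency packet `V[a] = ∫ a(k) V_k dk / (2 ω̄(k))` over `[k₁, k₂]`. -/
def packetV (κ k₁ k₂ : ℝ) (a : ℝ → ℂ) (p : SpaceTime) : Spinor :=
  ∫ k in Set.Icc k₁ k₂, (a k / ((2 * freq κ k : ℝ) : ℂ)) • planeV κ k p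

end DiracPacket

end

/-! At a fixed time, each spinor component of a packet is a rescaled Fourier transform of its
amplitude times a unimodular phase. Plancherel therefore gives every time slice the same total mass
(`integral_norm_sq_wave`), so dividing by the mass at time 0 normalizes every slice.

For localization put `ξ = τ x`. The phase becomes `στ(ω̄(k) - k x)`, with `k`-derivative `στ(v_g(k)
- x)`. Since `v_g` increases, this stays away from 0 for `x` outside `[v₁, v₂]`. One integration by
parts bounds the squared modulus by `C / (τ² (1 + x²))` (`norm_wave_smul_le`), and since `dξ = |τ|
dx` the tail mass is `O(1/|τ|)`.

This needs a C¹ amplitude. A continuous one is approximated uniformly by polynomials, and Plancherel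
bounds the error uniformly in `τ` (`tendsto_tail`). -/

/-! ### Plancherel's theorem for Fourier integrals -/

open scoped ContDiff FourierTransform in
/-- The Fourier integral of an `L¹ ∩ L²` function represents its `L²` Fourier transform. -/
theorem fourier_toLp_ae_eq {f : ℝ → ℂ} (h1 : Integrable f) (h2 : MemLp f 2) :
    (𝓕 (h2.toLp f) : Lp ℂ 2 (volume : Measure ℝ)) =ᵐ[volume] 𝓕 f := by
  have hc : Continuous (𝓕 f) :=
    VectorFourier.fourierIntegral_continuous Real.continuous_fourierChar
      (L := innerₗ ℝ) continuous_inner h1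
  refine ae_eq_of_integral_contDiff_smul_eq
    ((Lp.memLp _).locallyIntegrable one_le_two) hc.locallyIntegrable ?_
  intro g g_smooth g_cpt
  -- Viewed as a Schwartz function, the test function lets the duality defining the distributional
  -- transform be compared with Fubini for the Fourier integral.
  have hg₁ : HasCompactSupport (Complex.ofRealCLM ∘ g) := g_cpt.comp_left rfl
  have hg₂ : ContDiff ℝ ∞ (Complex.ofRealCLM ∘ g) := by fun_prop
  set G := hg₁.toSchwartzMap hg₂ with hG
  have e1 := Lp.toTemperedDistribution_apply
    (𝓕 (h2.toLp f) : Lp ℂ 2 (volume : Measure ℝ)) G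
  rw [← Lp.fourier_toTemperedDistribution_eq, TemperedDistribution.fourier_apply,
    Lp.toTemperedDistribution_apply] at e1
  have e2 : ∫ x, (𝓕 G) x • (h2.toLp f) x = ∫ x, (𝓕 G) x • f x := by
    apply integral_congr_ae
    filter_upwards [h2.coeFn_toLp] with x hx
    rw [hx]
  have e3 : ∫ x, (𝓕 G) x • f x = ∫ x, G x • (𝓕 f) x := by
    simpa using! VectorFourier.integral_fourierIntegral_smul_eq_flip (L := innerₗ ℝ)
      Real.continuous_fourierChar continuous_inner G.integrable h1
  rw [e2, e3] at e1
  simpa [hG] using e1.symm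

open scoped FourierTransform in
theorem memLp_fourier {f : ℝ → ℂ} (h1 : Integrable f) (h2 : MemLp f 2) :
    MemLp (𝓕 f) 2 :=
  (memLp_congr_ae (fourier_toLp_ae_eq h1 h2)).1 (Lp.memLp _)

open scoped FourierTransform in
/-- Plancherel's theorem for the Fourier integral of an `L¹ ∩ L²` function. -/
theorem integral_norm_sq_fourier {f : ℝ → ℂ} (h1 : Integrable f) (h2 : MemLp f 2) :
    ∫ w, ‖𝓕 f w‖ ^ 2 = ∫ x, ‖f x‖ ^ 2 := by
  have key : ∀ {g : ℝ → ℂ} (hg : MemLp g 2), ∫ x, ‖g x‖ ^ 2 = ‖hg.toLp g‖ ^ 2 := by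
    intro g hg
    have := congrArg RCLike.re (L2.inner_def (𝕜 := ℂ) (hg.toLp g) (hg.toLp g))
    rw [inner_self_eq_norm_sq] at this
    rw [this, ← integral_re (L2.integrable_inner _ _)]
    apply integral_congr_ae
    filter_upwards [hg.coeFn_toLp] with x hx
    rw [hx, inner_self_eq_norm_sq]
  rw [key (memLp_fourier h1 h2), key h2, ← Lp.norm_fourier_eq (h2.toLp f)]
  congr 2
  exact Lp.ext ((memLp_fourier h1 h2).coeFn_toLp.trans (fourier_toLp_ae_eq h1 h2).symm)

/-! ### Oscillatory integrals -/

/-- Non-stationary phase: one integration by parts. -/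
theorem norm_integral_mul_exp_le {p p' : ℝ → ℂ} {φ g g' : ℝ → ℝ} {a b t M M' L q : ℝ}
    (hab : a ≤ b) (ht : t ≠ 0) (hq : 0 < q)
    (hp : ∀ x, HasDerivAt p (p' x) x) (hp' : Continuous p')
    (hφ : ∀ x, HasDerivAt φ (g x) x)
    (hg : ∀ x, HasDerivAt g (g' x) x) (hg' : Continuous g')
    (bp : ∀ x ∈ Set.Icc a b, ‖p x‖ ≤ M) (bp' : ∀ x ∈ Set.Icc a b, ‖p' x‖ ≤ M')
    (bg' : ∀ x ∈ Set.Icc a b, |g' x| ≤ L) (bg : ∀ x ∈ Set.Icc a b, q ≤ |g x|) :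
    ‖∫ x in a..b, p x * Complex.exp (Complex.I * ((t * φ x : ℝ) : ℂ))‖ ≤
      (2 * (M / q) + (M' / q + M * L / q ^ 2) * (b - a)) / |t| := by
  have hM : 0 ≤ M := (norm_nonneg _).trans (bp a (Set.left_mem_Icc.2 hab))
  have g0 : ∀ x ∈ Set.Icc a b, g x ≠ 0 := fun x hx h => by
    have := bg x hx
    rw [h, abs_zero] at this
    linarith
  set e : ℝ → ℂ := fun x => Complex.exp (Complex.I * ((t * φ x : ℝ) : ℂ)) with he
  have ne : ∀ x, ‖e x‖ = 1 := fun x => by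
    simp only [he]; rw [mul_comm]; exact Complex.norm_exp_ofReal_mul_I _
  have de : ∀ x, HasDerivAt e (Complex.I * t * g x * e x) x := fun x => by
    have := (((hφ x).const_mul t).ofReal_comp.const_mul Complex.I).cexp
    convert this using 1
    simp only [he]; push_cast; ring
  -- `r` is the derivative of `p / g`, so `(p / g * e)' = r * e + i t p e`: the integral of `i t p
  -- e` is a boundary term minus that of `r * e`.
  set r : ℝ → ℂ := fun x => p' x / g x - p x * g' x / (g x : ℂ) ^ 2 with hr
  have dF : ∀ x ∈ Set.Icc a b, HasDerivAt (fun x => p x / g x * e x)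
      (r x * e x + Complex.I * t * (p x * e x)) x := fun x hx => by
    have gx : (g x : ℂ) ≠ 0 := by exact_mod_cast g0 x hx
    refine HasDerivAt.congr_deriv ((hp x).div (hg x).ofReal_comp gx |>.mul (de x)) ?_
    simp only [hr, Pi.div_apply]; field_simp
  have cp : Continuous p := continuous_iff_continuousAt.2 fun x => (hp x).continuousAt
  have cg : Continuous g := continuous_iff_continuousAt.2 fun x => (hg x).continuousAt
  have ce : Continuous e := continuous_iff_continuousAt.2 fun x => (de x).continuousAt
  have cr : ContinuousOn (fun x => r x * e x) (Set.uIcc a b) := by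
    rw [Set.uIcc_of_le hab]
    refine ContinuousOn.mul (ContinuousOn.sub ?_ ?_) ce.continuousOn
    · exact hp'.continuousOn.div (Complex.continuous_ofReal.comp cg).continuousOn
        fun x hx => by exact_mod_cast g0 x hx
    · exact (cp.mul (Complex.continuous_ofReal.comp hg')).continuousOn.div
        ((Complex.continuous_ofReal.comp cg).pow 2).continuousOn
        fun x hx => pow_ne_zero 2 (by exact_mod_cast g0 x hx)
  have i1 : IntervalIntegrable (fun x => r x * e x) volume a b := cr.intervalIntegrable
  have i2 : IntervalIntegrable (fun x => Complex.I * t * (p x * e x)) volume a b :=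
    (continuous_const.mul (cp.mul ce)).intervalIntegrable _ _
  have ftc := intervalIntegral.integral_eq_sub_of_hasDerivAt (a := a) (b := b)
    (fun x hx => dF x (by rwa [Set.uIcc_of_le hab] at hx)) (i1.add i2)
  rw [intervalIntegral.integral_add i1 i2, intervalIntegral.integral_const_mul] at ftc
  have bF : ∀ x ∈ Set.Icc a b, ‖p x / g x * e x‖ ≤ M / q := fun x hx => by
    rw [norm_mul, ne, mul_one, norm_div, Complex.norm_real, Real.norm_eq_abs]
    exact div_le_div₀ hM (bp x hx) hq (bg x hx)
  have br : ∀ x ∈ Set.Icc a b, ‖r x * e x‖ ≤ M' / q + M * L / q ^ 2 := fun x hx => by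
    rw [norm_mul, ne, mul_one]
    refine (norm_sub_le _ _).trans (add_le_add ?_ ?_)
    · rw [norm_div, Complex.norm_real, Real.norm_eq_abs]
      exact div_le_div₀ ((norm_nonneg _).trans (bp' x hx)) (bp' x hx) hq (bg x hx)
    · rw [norm_div, norm_mul, norm_pow, Complex.norm_real, Complex.norm_real, Real.norm_eq_abs,
        Real.norm_eq_abs]
      have hL : 0 ≤ L := (abs_nonneg _).trans (bg' x hx)
      refine div_le_div₀ (by positivity) (mul_le_mul (bp x hx) (bg' x hx) (abs_nonneg _) hM)
        (by positivity) (pow_le_pow_left₀ hq.le (bg x hx) 2)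
  have bI : ‖∫ x in a..b, r x * e x‖ ≤ (M' / q + M * L / q ^ 2) * (b - a) := by
    have := intervalIntegral.norm_integral_le_of_norm_le_const (a := a) (b := b)
      (f := fun x => r x * e x) (C := M' / q + M * L / q ^ 2) fun x hx => br x (by
        rw [Set.uIoc_of_le hab] at hx
        exact Set.Ioc_subset_Icc_self hx)
    rwa [abs_of_nonneg (sub_nonneg.2 hab)] at this
  rw [le_div_iff₀ (abs_pos.2 ht)]
  calc ‖∫ x in a..b, p x * e x‖ * |t|
      = ‖Complex.I * t * ∫ x in a..b, p x * e x‖ := by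
        rw [norm_mul, norm_mul, Complex.norm_I, one_mul, Complex.norm_real, Real.norm_eq_abs,
          mul_comm]
    _ = ‖p b / g b * e b - p a / g a * e a - ∫ x in a..b, r x * e x‖ := by
        rw [← ftc]; congr 1; ring
    _ ≤ _ := (norm_sub_le _ _).trans (add_le_add ((norm_sub_le _ _).trans ?_) bI)
  linarith [bF a (Set.left_mem_Icc.2 hab), bF b (Set.right_mem_Icc.2 hab)]

namespace DiracPacket

/-! ### Frequency and group velocity -/

theorem freq_pos {κ : ℝ} (hκ : 0 < κ) (k : ℝ) : 0 < freq κ k :=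
  Real.sqrt_pos.2 (by positivity)

theorem sq_freq (κ k : ℝ) : freq κ k ^ 2 = κ ^ 2 + k ^ 2 :=
  Real.sq_sqrt (by positivity)

theorem continuous_freq (κ : ℝ) : Continuous (freq κ) := by
  unfold freq; fun_prop

theorem abs_groupVelocity_le_one {κ : ℝ} (hκ : 0 < κ) (k : ℝ) : |groupVelocity κ k| ≤ 1 := by
  rw [groupVelocity, abs_div, abs_of_pos (freq_pos hκ k), div_le_one (freq_pos hκ k)]
  refine abs_le_of_sq_le_sq ?_ (freq_pos hκ k).le
  rw [sq_freq]
  nlinarith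

theorem hasDerivAt_groupVelocity {κ : ℝ} (hκ : 0 < κ) (k : ℝ) :
    HasDerivAt (groupVelocity κ) (κ ^ 2 / freq κ k ^ 3) k := by
  have h0 := (freq_pos hκ k).ne'
  refine ((hasDerivAt_id k).div (hasDerivAt_freq hκ k) h0).congr_deriv ?_
  have h1 := sq_freq κ k
  simp only [groupVelocity, id]
  field_simp
  linarith

theorem groupVelocity_mono {κ : ℝ} (hκ : 0 < κ) : Monotone (groupVelocity κ) :=
  monotone_of_hasDerivAt_nonneg (hasDerivAt_groupVelocity hκ) fun k => by
    have := freq_pos hκ k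
    simp only [Pi.zero_apply]
    positivity

/-! ### Scalar waves with differentiable amplitude -/

/-- One component of a wave packet: frequency sign `-σ`, amplitude `b`. -/
noncomputable def wave (κ k₁ k₂ σ : ℝ) (b : ℝ → ℂ) (τ ξ : ℝ) : ℂ :=
  ((Real.sqrt (2 * Real.pi) : ℝ) : ℂ)⁻¹ * ∫ k in k₁..k₂,
    b k * Complex.exp (Complex.I * ((σ * (freq κ k * τ - k * ξ) : ℝ) : ℂ))

/-- The amplitude whose Fourier transform is the time slice of a wave. -/
noncomputable def sliceAmplitude (κ k₁ k₂ σ : ℝ) (b : ℝ → ℂ) (τ : ℝ) : ℝ → ℂ :=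
  (Set.Icc k₁ k₂).indicator fun k =>
    b k * Complex.exp (Complex.I * ((σ * (freq κ k * τ) : ℝ) : ℂ))

section

variable {κ k₁ k₂ σ : ℝ} {b : ℝ → ℂ}

theorem norm_mul_exp_I (z : ℂ) (r : ℝ) : ‖z * Complex.exp (Complex.I * (r : ℂ))‖ = ‖z‖ := by
  rw [norm_mul, mul_comm Complex.I, Complex.norm_exp_ofReal_mul_I, mul_one]

theorem memLp_sliceAmplitude (hb : ContinuousOn b (Set.Icc k₁ k₂)) (τ : ℝ) (p : ENNReal) :
    MemLp (sliceAmplitude κ k₁ k₂ σ b τ) p := by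
  have hf := continuous_freq κ
  have hc : ContinuousOn (fun k => b k *
      Complex.exp (Complex.I * ((σ * (freq κ k * τ) : ℝ) : ℂ))) (Set.Icc k₁ k₂) :=
    hb.mul (by fun_prop)
  obtain ⟨C, hC⟩ := isCompact_Icc.exists_bound_of_continuousOn hc
  rw [sliceAmplitude, memLp_indicator_iff_restrict measurableSet_Icc]
  exact MemLp.of_bound (hc.aestronglyMeasurable measurableSet_Icc) C
    ((ae_restrict_iff' measurableSet_Icc).2 (ae_of_all _ hC))

open scoped FourierTransform in
theorem wave_eq_fourier (hk : k₁ ≤ k₂) (τ ξ : ℝ) :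
    wave κ k₁ k₂ σ b τ ξ = ((Real.sqrt (2 * Real.pi) : ℝ) : ℂ)⁻¹ *
      𝓕 (sliceAmplitude κ k₁ k₂ σ b τ) (σ / (2 * Real.pi) * ξ) := by
  rw [wave, Real.fourier_real_eq_integral_exp_smul, intervalIntegral.integral_of_le hk,
    ← integral_Icc_eq_integral_Ioc, ← integral_indicator measurableSet_Icc]
  congr 2
  funext k
  by_cases hx : k ∈ Set.Icc k₁ k₂
  · rw [sliceAmplitude, Set.indicator_of_mem hx, Set.indicator_of_mem hx, smul_eq_mul,
      mul_left_comm, ← Complex.exp_add]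
    congr 2
    have : (Real.pi : ℂ) ≠ 0 := by exact_mod_cast Real.pi_ne_zero
    push_cast
    field_simp
    ring
  · rw [sliceAmplitude, Set.indicator_of_notMem hx, Set.indicator_of_notMem hx, smul_zero]

theorem norm_sq_const_mul (z : ℂ) :
    ‖((Real.sqrt (2 * Real.pi) : ℝ) : ℂ)⁻¹ * z‖ ^ 2 = (2 * Real.pi)⁻¹ * ‖z‖ ^ 2 := by
  rw [norm_mul, mul_pow, norm_inv, Complex.norm_real, Real.norm_eq_abs, inv_pow, sq_abs,
    Real.sq_sqrt (by positivity)]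

theorem integrable_norm_sq_wave (hk : k₁ ≤ k₂) (hσ : |σ| = 1)
    (hb : ContinuousOn b (Set.Icc k₁ k₂)) (τ : ℝ) :
    Integrable fun ξ => ‖wave κ k₁ k₂ σ b τ ξ‖ ^ 2 := by
  have h1 := memLp_one_iff_integrable.1 (memLp_sliceAmplitude (κ := κ) (σ := σ) hb τ 1)
  have h2 := memLp_sliceAmplitude (κ := κ) (σ := σ) hb τ 2
  have hσ0 : σ ≠ 0 := by rintro rfl; simp at hσ
  simp_rw [wave_eq_fourier hk, norm_sq_const_mul]
  exact ((memLp_fourier h1 h2).integrable_norm_pow two_ne_zero |>.comp_mul_left'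
    (div_ne_zero hσ0 (by positivity))).const_mul _

/-- The Jacobian `2π` of `w = σξ/(2π)` cancels the prefactor, and the unimodular phase removes `τ`.
-/
theorem integral_norm_sq_wave (hk : k₁ ≤ k₂) (hσ : |σ| = 1)
    (hb : ContinuousOn b (Set.Icc k₁ k₂)) (τ : ℝ) :
    ∫ ξ, ‖wave κ k₁ k₂ σ b τ ξ‖ ^ 2 = ∫ k in k₁..k₂, ‖b k‖ ^ 2 := by
  have h1 := memLp_one_iff_integrable.1 (memLp_sliceAmplitude (κ := κ) (σ := σ) hb τ 1)
  have h2 := memLp_sliceAmplitude (κ := κ) (σ := σ) hb τ 2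
  simp_rw [wave_eq_fourier hk, norm_sq_const_mul]
  rw [integral_const_mul, Measure.integral_comp_mul_left
    (fun w => ‖FourierTransform.fourier (sliceAmplitude κ k₁ k₂ σ b τ) w‖ ^ 2),
    integral_norm_sq_fourier h1 h2, inv_div, abs_div, hσ, div_one, smul_eq_mul,
    abs_of_pos (by positivity), inv_mul_cancel_left₀ (by positivity),
    intervalIntegral.integral_of_le hk, ← integral_Icc_eq_integral_Ioc,
    ← integral_indicator measurableSet_Icc]
  congr 1
  funext k
  by_cases hx : k ∈ Set.Icc k₁ k₂
  · rw [sliceAmplitude, Set.indicator_of_mem hx, Set.indicator_of_mem hx, norm_mul_exp_I]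
  · rw [sliceAmplitude, Set.indicator_of_notMem hx, Set.indicator_of_notMem hx]
    simp

theorem wave_sub {b' : ℝ → ℂ} (hk : k₁ ≤ k₂) (hb : ContinuousOn b (Set.Icc k₁ k₂))
    (hb' : ContinuousOn b' (Set.Icc k₁ k₂)) (τ ξ : ℝ) :
    wave κ k₁ k₂ σ (fun k => b k - b' k) τ ξ =
      wave κ k₁ k₂ σ b τ ξ - wave κ k₁ k₂ σ b' τ ξ := by
  have hf := continuous_freq κ
  have hi : ∀ {c : ℝ → ℂ}, ContinuousOn c (Set.Icc k₁ k₂) → IntervalIntegrable (fun k => c k *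
      Complex.exp (Complex.I * ((σ * (freq κ k * τ - k * ξ) : ℝ) : ℂ))) volume k₁ k₂ :=
    fun {c} hc => by
      refine ContinuousOn.intervalIntegrable ?_
      rw [Set.uIcc_of_le hk]
      exact hc.mul (by fun_prop)
  simp only [wave, ← mul_sub, sub_mul]
  rw [intervalIntegral.integral_sub (hi hb) (hi hb')]

theorem norm_wave_smul_le {p p' : ℝ → ℂ} {v₁ v₂ : ℝ} (hκ : 0 < κ) (hk : k₁ ≤ k₂) (hσ : |σ| = 1)
    (hp : ∀ x, HasDerivAt p (p' x) x) (hp' : Continuous p')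
    (hv₁ : v₁ < groupVelocity κ k₁) (hv₂ : groupVelocity κ k₂ < v₂) :
    ∃ C : ℝ, ∀ τ x : ℝ, τ ≠ 0 → x ∉ Set.Icc v₁ v₂ →
      ‖wave κ k₁ k₂ σ p τ (τ * x)‖ ^ 2 ≤ C / τ ^ 2 * (1 + x ^ 2)⁻¹ := by
  have cp : Continuous p := continuous_iff_continuousAt.2 fun x => (hp x).continuousAt
  have cf := continuous_freq κ
  have cg' : Continuous fun k => κ ^ 2 / freq κ k ^ 3 :=
    continuous_const.div (cf.pow 3) fun k => (pow_pos (freq_pos hκ k) 3).ne'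
  obtain ⟨M, hM⟩ := isCompact_Icc.exists_bound_of_continuousOn (cp.continuousOn (s := Set.Icc k₁ k₂))
  obtain ⟨M', hM'⟩ :=
    isCompact_Icc.exists_bound_of_continuousOn (hp'.continuousOn (s := Set.Icc k₁ k₂))
  obtain ⟨L, hL⟩ :=
    isCompact_Icc.exists_bound_of_continuousOn (cg'.continuousOn (s := Set.Icc k₁ k₂))
  have hl := Set.left_mem_Icc.2 hk
  have hM0 : 0 ≤ M := (norm_nonneg _).trans (hM _ hl)
  have hM'0 : 0 ≤ M' := (norm_nonneg _).trans (hM' _ hl)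
  have hL0 : 0 ≤ L := (norm_nonneg _).trans (hL _ hl)
  obtain ⟨δ, hδ, hδ₁, hδ₂⟩ : ∃ δ : ℝ, 0 < δ ∧ v₁ + δ ≤ groupVelocity κ k₁ ∧
      groupVelocity κ k₂ + δ ≤ v₂ :=
    ⟨min (groupVelocity κ k₁ - v₁) (v₂ - groupVelocity κ k₂),
      lt_min (by linarith) (by linarith),
      by linarith [min_le_left (groupVelocity κ k₁ - v₁) (v₂ - groupVelocity κ k₂)],
      by linarith [min_le_right (groupVelocity κ k₁ - v₁) (v₂ - groupVelocity κ k₂)]⟩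
  -- With `d = v_g(k) - x`, the bounds `|v_g| ≤ 1` and `|d| ≥ δ` give `1 + x² ≤ 2d² + 3 ≤ A d²`.
  set A : ℝ := 2 + 3 / δ ^ 2 with hA
  have hA0 : 0 < A := by positivity
  -- Since `q ≥ δ`, one factor of `1/q²` is replaced by `1/δ`, so that the whole bound becomes `B /
  -- q`.
  set B : ℝ := 2 * M + (M' + M * L / δ) * (k₂ - k₁) with hB
  refine ⟨(2 * Real.pi)⁻¹ * (B ^ 2 * A), fun τ x hτ hx => ?_⟩
  have hdist : ∀ k ∈ Set.Icc k₁ k₂, δ ≤ |groupVelocity κ k - x| := fun k hk => by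
    have h1 := groupVelocity_mono hκ hk.1
    have h2 := groupVelocity_mono hκ hk.2
    rcases not_and_or.1 hx with h | h
    · exact le_abs.2 (Or.inl (by linarith))
    · exact le_abs.2 (Or.inr (by linarith))
  have hx0 : 0 < 1 + x ^ 2 := by positivity
  set q : ℝ := max δ (Real.sqrt ((1 + x ^ 2) / A)) with hq
  have hqδ : δ ≤ q := le_max_left _ _
  have hq0 : 0 < q := hδ.trans_le hqδ
  have hqx : (1 + x ^ 2) / A ≤ q ^ 2 := by
    have h := le_max_right δ (Real.sqrt ((1 + x ^ 2) / A))
    calc (1 + x ^ 2) / A = Real.sqrt ((1 + x ^ 2) / A) ^ 2 := (Real.sq_sqrt (by positivity)).symm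
      _ ≤ q ^ 2 := pow_le_pow_left₀ (Real.sqrt_nonneg _) h 2
  have hqg : ∀ k ∈ Set.Icc k₁ k₂, q ≤ |groupVelocity κ k - x| := fun k hk => by
    refine max_le (hdist k hk) (Real.sqrt_le_iff.2 ⟨abs_nonneg _, ?_⟩)
    rw [div_le_iff₀ hA0, sq_abs]
    have h1 : δ ^ 2 ≤ (groupVelocity κ k - x) ^ 2 := by
      rw [← sq_abs (groupVelocity κ k - x)]
      exact pow_le_pow_left₀ hδ.le (hdist k hk) 2
    have h2 : 1 ≤ (groupVelocity κ k - x) ^ 2 * (1 / δ ^ 2) := by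
      rw [mul_one_div, le_div_iff₀ (by positivity), one_mul]
      exact h1
    have h3 : groupVelocity κ k ^ 2 ≤ 1 := (sq_le_one_iff_abs_le_one _).2
      (abs_groupVelocity_le_one hκ k)
    have h4 : (groupVelocity κ k - x) ^ 2 * A = 2 * (groupVelocity κ k - x) ^ 2 +
      3 * ((groupVelocity κ k - x) ^ 2 * (1 / δ ^ 2)) := by rw [hA]; ring
    rw [h4]
    -- `2(v - x)² + 3 - (1 + x²) = (2v - x)² + 2(1 - v²)`, where `v = v_g(k)`.
    nlinarith [sq_nonneg (2 * groupVelocity κ k - x)]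
  have key := norm_integral_mul_exp_le (φ := fun k => freq κ k - k * x) (t := σ * τ) hk
    (by
      have hσ0 : σ ≠ 0 := by rintro rfl; simp at hσ
      exact mul_ne_zero hσ0 hτ) hq0 hp hp'
    (fun k => (hasDerivAt_freq hκ k).sub (hasDerivAt_mul_const x))
    (fun k => (hasDerivAt_groupVelocity hκ k).sub_const x) cg' hM hM' hL hqg
  rw [abs_mul, hσ, one_mul] at key
  have hbound : (2 * (M / q) + (M' / q + M * L / q ^ 2) * (k₂ - k₁)) / |τ| ≤ B / q / |τ| := by
    gcongr
    have : M * L / q ^ 2 ≤ M * L / δ / q := by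
      rw [div_div, sq]
      gcongr
    calc 2 * (M / q) + (M' / q + M * L / q ^ 2) * (k₂ - k₁)
        ≤ 2 * (M / q) + (M' / q + M * L / δ / q) * (k₂ - k₁) := by
          gcongr
      _ = B / q := by rw [hB]; ring
  have heq : ‖wave κ k₁ k₂ σ p τ (τ * x)‖ ^ 2 = (2 * Real.pi)⁻¹ * ‖∫ k in k₁..k₂, p k *
      Complex.exp (Complex.I * ((σ * τ * (freq κ k - k * x) : ℝ) : ℂ))‖ ^ 2 := by
    rw [wave, norm_sq_const_mul]
    congr 4
    funext k
    rw [show σ * (freq κ k * τ - k * (τ * x)) = σ * τ * (freq κ k - k * x) by ring]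
  rw [heq]
  calc _ ≤ (2 * Real.pi)⁻¹ * (B / q / |τ|) ^ 2 := by
        gcongr
        exact key.trans hbound
    _ = (2 * Real.pi)⁻¹ * (B ^ 2 / τ ^ 2 * (q ^ 2)⁻¹) := by
        rw [div_pow, div_pow, sq_abs]; ring
    _ ≤ (2 * Real.pi)⁻¹ * (B ^ 2 / τ ^ 2 * ((1 + x ^ 2) / A)⁻¹) := by
        gcongr
    _ = _ := by rw [inv_div]; ring

theorem tendsto_tail_of_hasDerivAt {p p' : ℝ → ℂ} {v₁ v₂ : ℝ} (hκ : 0 < κ) (hk : k₁ ≤ k₂)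
    (hσ : |σ| = 1) (hp : ∀ x, HasDerivAt p (p' x) x) (hp' : Continuous p')
    (hv₁ : v₁ < groupVelocity κ k₁) (hv₂ : groupVelocity κ k₂ < v₂) :
    Tendsto (fun τ : ℝ => ∫ ξ in (τ • Set.Icc v₁ v₂)ᶜ, ‖wave κ k₁ k₂ σ p τ ξ‖ ^ 2)
      (cocompact ℝ) (𝓝 0) := by
  obtain ⟨C, hC⟩ := norm_wave_smul_le hκ hk hσ hp hp' hv₁ hv₂
  set K : ℝ := ∫ x in (Set.Icc v₁ v₂)ᶜ, (1 + x ^ 2)⁻¹ with hK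
  have hlim : Tendsto (fun τ : ℝ => C * K / ‖τ‖) (cocompact ℝ) (𝓝 0) :=
    tendsto_const_nhds.div_atTop (tendsto_norm_cocompact_atTop)
  refine squeeze_zero' (Eventually.of_forall fun τ => integral_nonneg fun ξ => by positivity)
    ?_ hlim
  -- For `τ ≠ 0` dilation is bijective, so it commutes with complements and rescales the integral by
  -- `|τ|`.
  filter_upwards [(isCompact_singleton (x := (0 : ℝ))).compl_mem_cocompact] with τ hτ
  replace hτ : τ ≠ 0 := hτ
  have hs := Measure.setIntegral_comp_smul volume (fun ξ => ‖wave κ k₁ k₂ σ p τ ξ‖ ^ 2)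
    (Set.Icc v₁ v₂)ᶜ hτ
  rw [show τ • (Set.Icc v₁ v₂)ᶜ = (τ • Set.Icc v₁ v₂)ᶜ from
    Set.image_compl_eq (MulAction.bijective₀ hτ), Module.finrank_self, pow_one, smul_eq_mul, abs_inv] at hs
  have hI : IntegrableOn (fun x : ℝ => C / τ ^ 2 * (1 + x ^ 2)⁻¹) (Set.Icc v₁ v₂)ᶜ :=
    (integrable_inv_one_add_sq.const_mul _).integrableOn
  have hle : ∫ x in (Set.Icc v₁ v₂)ᶜ, ‖wave κ k₁ k₂ σ p τ (τ • x)‖ ^ 2 ≤ C / τ ^ 2 * K := by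
    rw [hK, ← integral_const_mul]
    refine integral_mono_of_nonneg (ae_of_all _ fun x => by positivity) hI ?_
    exact (ae_restrict_iff' measurableSet_Icc.compl).2 (ae_of_all _ fun x hx => hC τ x hτ hx)
  rw [hs] at hle
  have hτ' : 0 < |τ| := abs_pos.2 hτ
  rw [inv_mul_le_iff₀ hτ'] at hle
  refine hle.trans (le_of_eq ?_)
  rw [Real.norm_eq_abs, ← sq_abs]
  field_simp

end

/-! ### Continuous amplitudes by approximation -/

section

variable {κ k₁ k₂ σ : ℝ} {b : ℝ → ℂ}

theorem exists_hasDerivAt_near_of_continuousOn (hb : ContinuousOn b (Set.Icc k₁ k₂)) {η : ℝ}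
    (hη : 0 < η) : ∃ p p' : ℝ → ℂ, (∀ x, HasDerivAt p (p' x) x) ∧ Continuous p' ∧
      ∀ x ∈ Set.Icc k₁ k₂, ‖b x - p x‖ ≤ η := by
  obtain ⟨P, hP⟩ := exists_polynomial_near_of_continuousOn k₁ k₂ (fun x => (b x).re)
    (Complex.continuous_re.comp_continuousOn hb) (η / 2) (half_pos hη)
  obtain ⟨Q, hQ⟩ := exists_polynomial_near_of_continuousOn k₁ k₂ (fun x => (b x).im)
    (Complex.continuous_im.comp_continuousOn hb) (η / 2) (half_pos hη)
  refine ⟨fun x => ((P.eval x : ℝ) : ℂ) + ((Q.eval x : ℝ) : ℂ) * Complex.I,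
    fun x => ((P.derivative.eval x : ℝ) : ℂ) + ((Q.derivative.eval x : ℝ) : ℂ) * Complex.I,
    fun x => (P.hasDerivAt x).ofReal_comp.add ((Q.hasDerivAt x).ofReal_comp.mul_const _),
    by fun_prop, fun x hx => ?_⟩
  refine (Complex.norm_le_abs_re_add_abs_im _).trans ?_
  have h1 := hP x hx
  have h2 := hQ x hx
  rw [abs_sub_comm] at h1 h2
  simp only [Complex.sub_re, Complex.sub_im, Complex.add_re, Complex.add_im, Complex.mul_re,
    Complex.mul_im, Complex.ofReal_re, Complex.ofReal_im, Complex.I_re, Complex.I_im, mul_zero,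
    mul_one, sub_zero, add_zero, zero_add]
  linarith

/-- A wave is asymptotically localized in the cone of its group velocities. -/
theorem tendsto_tail {v₁ v₂ : ℝ} (hκ : 0 < κ) (hk : k₁ ≤ k₂) (hσ : |σ| = 1)
    (hb : ContinuousOn b (Set.Icc k₁ k₂))
    (hv₁ : v₁ < groupVelocity κ k₁) (hv₂ : groupVelocity κ k₂ < v₂) :
    Tendsto (fun τ : ℝ => ∫ ξ in (τ • Set.Icc v₁ v₂)ᶜ, ‖wave κ k₁ k₂ σ b τ ξ‖ ^ 2)
      (cocompact ℝ) (𝓝 0) := by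
  have h0 : ∀ (b : ℝ → ℂ) (τ : ℝ),
      0 ≤ ∫ ξ in (τ • Set.Icc v₁ v₂)ᶜ, ‖wave κ k₁ k₂ σ b τ ξ‖ ^ 2 :=
    fun b τ => integral_nonneg fun ξ => by positivity
  rw [Metric.tendsto_nhds]
  intro ε hε
  -- The approximation error `η` satisfies `η² = ε / (4(k₂ - k₁) + 1)`, so `2η²(k₂ - k₁) ≤ ε/2`; the
  -- `+ 1` allows `k₁ = k₂`.
  have hD : 0 < 4 * (k₂ - k₁) + 1 := by linarith
  have hη : 0 < Real.sqrt (ε / (4 * (k₂ - k₁) + 1)) := Real.sqrt_pos.2 (by positivity)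
  obtain ⟨p, p', hp, hp', hbp⟩ := exists_hasDerivAt_near_of_continuousOn hb hη
  have cp : ContinuousOn p (Set.Icc k₁ k₂) := fun x _ => (hp x).continuousAt.continuousWithinAt
  have ht := (Metric.tendsto_nhds.1
    (tendsto_tail_of_hasDerivAt (σ := σ) hκ hk hσ hp hp' hv₁ hv₂)) (ε / 4) (by positivity)
  filter_upwards [ht] with τ hτ
  rw [Real.dist_eq, sub_zero, abs_of_nonneg (h0 _ _)] at hτ ⊢
  have cd : ContinuousOn (fun k => b k - p k) (Set.Icc k₁ k₂) := hb.sub cp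
  have id := integrable_norm_sq_wave (κ := κ) hk hσ cd τ
  have ip := integrable_norm_sq_wave (κ := κ) hk hσ cp τ
  have hd : ∫ ξ, ‖wave κ k₁ k₂ σ (fun k => b k - p k) τ ξ‖ ^ 2 ≤
      ε / (4 * (k₂ - k₁) + 1) * (k₂ - k₁) := by
    rw [integral_norm_sq_wave hk hσ cd]
    have := intervalIntegral.norm_integral_le_of_norm_le_const (a := k₁) (b := k₂)
      (f := fun k => ‖b k - p k‖ ^ 2) (C := ε / (4 * (k₂ - k₁) + 1)) fun x hx => by
        rw [Set.uIoc_of_le hk] at hx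
        rw [Real.norm_eq_abs, abs_of_nonneg (by positivity)]
        refine (pow_le_pow_left₀ (norm_nonneg _)
          (hbp x (Set.Ioc_subset_Icc_self hx)) 2).trans (Real.sq_sqrt (by positivity)).le
    rw [abs_of_nonneg (sub_nonneg.2 hk)] at this
    exact (le_abs_self _).trans this
  calc ∫ ξ in (τ • Set.Icc v₁ v₂)ᶜ, ‖wave κ k₁ k₂ σ b τ ξ‖ ^ 2
      ≤ ∫ ξ in (τ • Set.Icc v₁ v₂)ᶜ, (2 * ‖wave κ k₁ k₂ σ (fun k => b k - p k) τ ξ‖ ^ 2 +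
          2 * ‖wave κ k₁ k₂ σ p τ ξ‖ ^ 2) := by
        refine integral_mono_of_nonneg (ae_of_all _ fun ξ => by positivity)
          ((id.const_mul 2).add (ip.const_mul 2)).integrableOn (ae_of_all _ fun ξ => ?_)
        simp only [wave_sub hk hb cp]
        have := norm_le_norm_sub_add (wave κ k₁ k₂ σ b τ ξ) (wave κ k₁ k₂ σ p τ ξ)
        nlinarith [norm_nonneg (wave κ k₁ k₂ σ b τ ξ), sq_nonneg
          (‖wave κ k₁ k₂ σ b τ ξ - wave κ k₁ k₂ σ p τ ξ‖ - ‖wave κ k₁ k₂ σ p τ ξ‖)]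
    _ = 2 * (∫ ξ in (τ • Set.Icc v₁ v₂)ᶜ, ‖wave κ k₁ k₂ σ (fun k => b k - p k) τ ξ‖ ^ 2) +
          2 * ∫ ξ in (τ • Set.Icc v₁ v₂)ᶜ, ‖wave κ k₁ k₂ σ p τ ξ‖ ^ 2 := by
        rw [integral_add (id.const_mul 2).integrableOn (ip.const_mul 2).integrableOn,
          integral_const_mul, integral_const_mul]
    _ ≤ 2 * (ε / (4 * (k₂ - k₁) + 1) * (k₂ - k₁)) +
          2 * ∫ ξ in (τ • Set.Icc v₁ v₂)ᶜ, ‖wave κ k₁ k₂ σ p τ ξ‖ ^ 2 := by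
        gcongr
        exact (setIntegral_le_integral id (ae_of_all _ fun ξ => by positivity)).trans hd
    _ < ε / 2 + 2 * (ε / 4) := by
        have : 2 * (ε / (4 * (k₂ - k₁) + 1) * (k₂ - k₁)) ≤ ε / 2 := by
          rw [div_mul_eq_mul_div, mul_div_assoc', div_le_iff₀ hD]
          linarith
        linarith
    _ = ε := by ring

/-! ### From scalar waves to spinor densities -/

theorem density_localization {b₀ b₁ : ℝ → ℂ} {v₁ v₂ : ℝ} {ψ : SpaceTime → Spinor}
    (hκ : 0 < κ) (hk : k₁ ≤ k₂) (hσ : |σ| = 1)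
    (hb₀ : ContinuousOn b₀ (Set.Icc k₁ k₂)) (hb₁ : ContinuousOn b₁ (Set.Icc k₁ k₂))
    (hpos : 0 < ∫ k in k₁..k₂, ‖b₀ k‖ ^ 2)
    (hv₁ : v₁ < groupVelocity κ k₁) (hv₂ : groupVelocity κ k₂ < v₂)
    (hψ₀ : ∀ τ ξ, ψ (τ, ξ) 0 = wave κ k₁ k₂ σ b₀ τ ξ)
    (hψ₁ : ∀ τ ξ, ψ (τ, ξ) 1 = wave κ k₁ k₂ σ b₁ τ ξ) :
    (∀ τ : ℝ, Integrable (density ψ τ) ∧ ∫ ξ : ℝ, density ψ τ ξ = 1) ∧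
    Tendsto (fun τ : ℝ => ∫ ξ in τ • Set.Icc v₁ v₂, density ψ τ ξ) (cocompact ℝ) (𝓝 1) := by
  set N : ℝ := (∫ k in k₁..k₂, ‖b₀ k‖ ^ 2) + ∫ k in k₁..k₂, ‖b₁ k‖ ^ 2 with hN
  have hN0 : 0 < N := add_pos_of_pos_of_nonneg hpos
    (intervalIntegral.integral_nonneg hk fun k _ => by positivity)
  have hcur : ∀ τ ξ, current ψ 0 (τ, ξ) =
      ‖wave κ k₁ k₂ σ b₀ τ ξ‖ ^ 2 + ‖wave κ k₁ k₂ σ b₁ τ ξ‖ ^ 2 := fun τ ξ => by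
    rw [current_zero, hψ₀, hψ₁]
  have i₀ := integrable_norm_sq_wave (κ := κ) hk hσ hb₀
  have i₁ := integrable_norm_sq_wave (κ := κ) hk hσ hb₁
  have hint : ∀ τ, ∫ ξ, current ψ 0 (τ, ξ) = N := fun τ => by
    simp_rw [hcur]
    rw [integral_add (i₀ τ) (i₁ τ), integral_norm_sq_wave hk hσ hb₀,
      integral_norm_sq_wave hk hσ hb₁]
  have hnorm : sliceNorm ψ 0 ^ 2 = N := by
    rw [sliceNorm, hint, Real.sq_sqrt hN0.le]
  have hden : ∀ τ ξ, density ψ τ ξ =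
      (‖wave κ k₁ k₂ σ b₀ τ ξ‖ ^ 2 + ‖wave κ k₁ k₂ σ b₁ τ ξ‖ ^ 2) / N := fun τ ξ => by
    rw [density, hnorm, hcur]
  have hdi : ∀ τ, Integrable (density ψ τ) := fun τ => by
    rw [funext (hden τ)]
    exact ((i₀ τ).add (i₁ τ)).div_const N
  have hd1 : ∀ τ, ∫ ξ, density ψ τ ξ = 1 := fun τ => by
    simp only [density, hnorm]
    rw [integral_div, hint, div_self hN0.ne']
  refine ⟨fun τ => ⟨hdi τ, hd1 τ⟩, ?_⟩
  -- The mass in the cone is 1 minus the normalized tails of the two components.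
  have ht := (((tendsto_tail (σ := σ) hκ hk hσ hb₀ hv₁ hv₂).add
    (tendsto_tail (σ := σ) hκ hk hσ hb₁ hv₁ hv₂)).div_const N).const_sub 1
  simp only [add_zero, zero_div, sub_zero] at ht
  refine ht.congr fun τ => ?_
  have hm : MeasurableSet (τ • Set.Icc v₁ v₂) :=
    (isCompact_Icc.smul τ).measurableSet
  rw [← hd1 τ, ← integral_add_compl hm (hdi τ), ← integral_add (i₀ τ).integrableOn
    (i₁ τ).integrableOn, ← integral_div]
  simp_rw [← hden]
  ring

/-- Taking a component is continuous and linear, so it commutes with the Bochner integral. -/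
theorem integral_packet_apply (hk : k₁ ≤ k₂) {c : ℝ → ℂ} {s : ℝ → Spinor}
    (hc : ContinuousOn c (Set.Icc k₁ k₂)) (hs : Continuous s) (τ ξ : ℝ) (i : Fin 2) :
    (∫ k in Set.Icc k₁ k₂, c k • ((((Real.sqrt (2 * Real.pi) : ℝ) : ℂ)⁻¹ *
      Complex.exp (Complex.I * ((σ * (freq κ k * τ - k * ξ) : ℝ) : ℂ))) • s k)) i =
      wave κ k₁ k₂ σ (fun k => c k * s k i) τ ξ := by
  have hf := continuous_freq κ
  have hi : IntegrableOn (fun k => c k • ((((Real.sqrt (2 * Real.pi) : ℝ) : ℂ)⁻¹ *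
      Complex.exp (Complex.I * ((σ * (freq κ k * τ - k * ξ) : ℝ) : ℂ))) • s k))
      (Set.Icc k₁ k₂) := by
    refine ContinuousOn.integrableOn_compact isCompact_Icc (hc.smul (Continuous.continuousOn ?_))
    fun_prop
  have h := (EuclideanSpace.proj i : Spinor →L[ℂ] ℂ).integral_comp_comm hi
  refine h.symm.trans ?_
  rw [wave, intervalIntegral.integral_of_le hk, ← integral_Icc_eq_integral_Ioc,
    ← integral_const_mul]
  congr 1
  funext k
  simp only [PiLp.proj_apply, PiLp.smul_apply, smul_eq_mul]
  ring

theorem continuous_bigOmega (κ : ℝ) : Continuous (bigOmega κ) := by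
  have := continuous_freq κ
  unfold bigOmega; fun_prop

/-- Strict because `κ > 0` forces `|k| < ω̄(k)`; hence the first spinor component never vanishes and
the packet has positive mass. -/
theorem bigOmega_pos (hκ : 0 < κ) (k : ℝ) : 0 < bigOmega κ k := by
  have h : |k| < freq κ k := Real.lt_sqrt_of_sq_lt (by rw [sq_abs]; nlinarith)
  exact Real.sqrt_pos.2 (by linarith [neg_abs_le k])

theorem continuous_spinorU (κ : ℝ) : Continuous (spinorU κ) := by
  have := continuous_bigOmega κ
  refine (PiLp.continuous_toLp 2 _).comp (continuous_pi fun i => ?_)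
  fin_cases i <;> simp <;> fun_prop

theorem continuous_spinorV (κ : ℝ) : Continuous (spinorV κ) := by
  have := continuous_bigOmega κ
  refine (PiLp.continuous_toLp 2 _).comp (continuous_pi fun i => ?_)
  fin_cases i <;> simp <;> fun_prop

theorem packetU_apply (hk : k₁ ≤ k₂) {a : ℝ → ℂ}
    (hc : ContinuousOn (fun k => a k / ((2 * freq κ k : ℝ) : ℂ)) (Set.Icc k₁ k₂))
    (τ ξ : ℝ) (i : Fin 2) : packetU κ k₁ k₂ a (τ, ξ) i =
      wave κ k₁ k₂ (-1) (fun k => a k / ((2 * freq κ k : ℝ) : ℂ) * spinorU κ k i) τ ξ := by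
  rw [← integral_packet_apply hk hc (continuous_spinorU κ)]
  simp only [packetU, planeU, neg_mul, one_mul, Complex.ofReal_neg, mul_neg]

theorem packetV_apply (hk : k₁ ≤ k₂) {a : ℝ → ℂ}
    (hc : ContinuousOn (fun k => a k / ((2 * freq κ k : ℝ) : ℂ)) (Set.Icc k₁ k₂))
    (τ ξ : ℝ) (i : Fin 2) : packetV κ k₁ k₂ a (τ, ξ) i =
      wave κ k₁ k₂ 1 (fun k => a k / ((2 * freq κ k : ℝ) : ℂ) * spinorV κ k i) τ ξ := by
  rw [← integral_packet_apply hk hc (continuous_spinorV κ)]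
  simp only [packetV, planeV, one_mul]

theorem packet_localization {s : ℝ → Spinor} {a : ℝ → ℂ} {v₁ v₂ : ℝ} {ψ : SpaceTime → Spinor}
    (hκ : 0 < κ) (hk : k₁ < k₂) (hσ : |σ| = 1)
    (hc : ContinuousOn (fun k => a k / ((2 * freq κ k : ℝ) : ℂ)) (Set.Icc k₁ k₂))
    (hs : Continuous s) (hs0 : ∀ k, s k 0 ≠ 0) (ha0 : ∃ k ∈ Set.Icc k₁ k₂, a k ≠ 0)
    (hv₁ : v₁ < groupVelocity κ k₁) (hv₂ : groupVelocity κ k₂ < v₂)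
    (hψ : ∀ τ ξ i, ψ (τ, ξ) i =
      wave κ k₁ k₂ σ (fun k => a k / ((2 * freq κ k : ℝ) : ℂ) * s k i) τ ξ) :
    (∀ τ : ℝ, Integrable (density ψ τ) ∧ ∫ ξ : ℝ, density ψ τ ξ = 1) ∧
    Tendsto (fun τ : ℝ => ∫ ξ in τ • Set.Icc v₁ v₂, density ψ τ ξ) (cocompact ℝ) (𝓝 1) := by
  have hb : ∀ i, ContinuousOn (fun k => a k / ((2 * freq κ k : ℝ) : ℂ) * s k i)
      (Set.Icc k₁ k₂) := fun i => hc.mul (by fun_prop)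
  refine density_localization hκ hk.le hσ (hb 0) (hb 1) ?_ hv₁ hv₂
    (fun τ ξ => hψ τ ξ 0) (fun τ ξ => hψ τ ξ 1)
  obtain ⟨k, hk', hak⟩ := ha0
  refine intervalIntegral.integral_pos hk ((hb 0).norm.pow 2) (fun x _ => by positivity)
    ⟨k, hk', pow_pos (norm_pos_iff.2 (mul_ne_zero (div_ne_zero hak ?_) (hs0 k))) 2⟩
  have := freq_pos hκ k
  exact_mod_cast (by positivity : 2 * freq κ k ≠ 0)

end

end DiracPacket

theorem mainTheorem5 (κ : ℝ) (hκ : 0 < κ) (k₁ k₂ : ℝ) (hk : k₁ < k₂)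
    (a : ℝ → ℂ) (ha : ContinuousOn a (Set.Icc k₁ k₂))
    (ha0 : ∃ k ∈ Set.Icc k₁ k₂, a k ≠ 0)
    (v₁ v₂ : ℝ)
    (hv₁ : v₁ < DiracPacket.groupVelocity κ k₁)
    (hv₂ : DiracPacket.groupVelocity κ k₂ < v₂)
    (ψ : DiracPacket.SpaceTime → DiracPacket.Spinor)
    (hψ : ψ = DiracPacket.packetU κ k₁ k₂ a ∨ ψ = DiracPacket.packetV κ k₁ k₂ a) :
    (∀ τ : ℝ, Integrable (DiracPacket.density ψ τ) ∧ ∫ ξ : ℝ, DiracPacket.density ψ τ ξ = 1) ∧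
    Tendsto (fun τ : ℝ => ∫ ξ in τ • Set.Icc v₁ v₂, DiracPacket.density ψ τ ξ) atTop (𝓝 1) ∧
    Tendsto (fun τ : ℝ => ∫ ξ in τ • Set.Icc v₁ v₂, DiracPacket.density ψ τ ξ) atBot (𝓝 1) := by
  have hf := DiracPacket.continuous_freq κ
  have hc : ContinuousOn (fun k => a k / ((2 * DiracPacket.freq κ k : ℝ) : ℂ))
      (Set.Icc k₁ k₂) :=
    ha.div (by fun_prop) fun k _ => by
      have := DiracPacket.freq_pos hκ k
      exact_mod_cast (by positivity : 2 * DiracPacket.freq κ k ≠ 0)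
  have hΩ : ∀ k, (DiracPacket.bigOmega κ k : ℂ) ≠ 0 := fun k => by
    exact_mod_cast (DiracPacket.bigOmega_pos hκ k).ne'
  -- One limit along `cocompact ℝ` contains both `τ → +∞` and `τ → -∞`.
  suffices h : (∀ τ : ℝ, Integrable (DiracPacket.density ψ τ) ∧
      ∫ ξ : ℝ, DiracPacket.density ψ τ ξ = 1) ∧
      Tendsto (fun τ : ℝ => ∫ ξ in τ • Set.Icc v₁ v₂, DiracPacket.density ψ τ ξ)
        (cocompact ℝ) (𝓝 1) from
    ⟨h.1, h.2.mono_left atTop_le_cocompact, h.2.mono_left atBot_le_cocompact⟩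
  rcases hψ with rfl | rfl
  · exact DiracPacket.packet_localization hκ hk (by simp) hc (DiracPacket.continuous_spinorU κ)
      (fun k => by simpa [DiracPacket.spinorU] using hΩ k) ha0 hv₁ hv₂
      (DiracPacket.packetU_apply hk.le hc)
  · exact DiracPacket.packet_localization hκ hk (by simp) hc (DiracPacket.continuous_spinorV κ)
      (fun k => by simpa [DiracPacket.spinorV] using hΩ k) ha0 hv₁ hv₂
      (DiracPacket.packetV_apply hk.le hc)
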